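/- **Setting.** A consumer faces a finite set $M$ of products and buys exactly one. Initially every product can be inspected and none can be purchased; inspecting product $k$ costs $c_k>0$, reveals its purchase value $u_k$, and makes the purchase of $k$ available; a purchase yields $u_k$ and ends the search. Before inspection $u_k$ is believed to have a distribution $F_k$ with finite mean. Assume *Independence* (inspecting a product does not change the belief about any other uninspected product) and *Invariance* (unselected inspections and purchases remain available, with unchanged costs and purchase values). The value of the action "inspect $k$" is the reservation value $z_k$, defined by $c_k=\int_{u>z_k}(u-z_k)\,dF_k(u)$; the value of "purchase $k$" is $u_k$. A search process consists of its inspections in order (steps $1,\dots,J$) and the purchase (step $J+1$). It is *optimal* if at every step the selected action attains the maximum in the Bellman equation of the search problem, i.e. maximizes, over the available actions, the expected payoff under optimal continuation. **Incomplete observation.** The data record the selected action at the steps of some nonempty set of *observed* steps. At each step, the inspection status of some products is known (for an observed inspection step this includes the inspected product), and for the other products it may be unknown. A product $k$ of known status contributes its available action (inspection or purchase) to the observed choice set of the step; a product $k$ of unknown status contributes a single unidentified action with the effective value $w_k=\min\{z_k,u_k\}$. If the purchased product $h$ has unknown status at the last step, and that step is observed, the action selected there is recorded as the unidentified action of $h$,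 with value $w_h$. Let $v_j$ be the value of the action recorded as selected at the observed step $j$. An observed step is *forward-accessible* if its observed choice set contains an unselected alternative that is the recorded selection of a later observed step. The *core value* $y$ is the minimum of $v_j$ over the observed steps $j$ that are not forward-accessible. An identified action is *unselected* if it is selected at no step of the process; an unidentified action of $k$ is unselected if $k$ is not purchased. **Theorem 2.** Under Independence and Invariance, if the search process is optimal, then for every such observation: 1. for all observed steps $j<j+t$ such that the action recorded as selected at step $j+t$ belongs to the observed choice set of step $j$, one has $v_{j}\ge v_{j+t}$, and $v_j>v_{j+t}$ if no two actions in the observed choice set of step $j$ have equal values (no ties in the ranking); 2. the core value $y$ exists, and every unselected action that belongs to the observed choice set of some step has value at most $y$. -/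

import Mathlib

open MeasureTheory

/-- A history of a search: the products inspected so far together with the purchase values that
these inspections revealed, in chronological order. -/
abbrev History (M : Type*) := List (M × ℝ)

/-- The actions of the sequential search model with product set `M`. -/
inductive SearchAction (M : Type*) where
  | inspect (k : M)
  | purchase (k : M)

/-- The product that an action concerns. -/
def SearchAction.product {M : Type*} : SearchAction M → M
  | .inspect k => k
  | .purchase k => k

/-- A sequential search problem of a consumer with unit demand and product set `M`.
All primitives may depend on the history, so that neither Independence nor Invariance is
built in. -/
structure SearchProblem (M : Type*) where
  /-- products that can be inspected after a history -/
  inspectable : History M → Set M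
  /-- products that can be purchased after a history -/
  purchasable : History M → Set M
  /-- `belief h k`: the consumer's belief, after history `h`, about the purchase value that an
  inspection of `k` will reveal -/
  belief : History M → M → Measure ℝ
  /-- `cost h k`: the cost of inspecting `k` after history `h` -/
  cost : History M → M → ℝ
  /-- `utility h k`: the utility of purchasing `k` after history `h` -/
  utility : History M → M → ℝ
  belief_prob : ∀ h k, IsProbabilityMeasure (belief h k)
  belief_integrable : ∀ h k, Integrable (fun x : ℝ => x) (belief h k)
  cost_pos : ∀ h k, 0 < cost h k
  /-- at the outset every product can be inspected -/
  inspectable_nil : ∀ k, k ∈ inspectable []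
  /-- an inspection is selected at most once -/
  not_inspected : ∀ h k, k ∈ inspectable h → ∀ x, (k, x) ∉ h
  /-- only inspected products can be purchased -/
  inspected_of_purchasable : ∀ h k, k ∈ purchasable h → ∃ x, (k, x) ∈ h
  /-- inspecting a product makes its purchase available -/
  purchasable_reveal : ∀ h k x, k ∈ inspectable h → k ∈ purchasable (h ++ [(k, x)])
  /-- inspecting a product reveals the utility of purchasing it -/
  utility_reveal : ∀ h k x, k ∈ inspectable h → utility (h ++ [(k, x)]) k = x

namespace SearchProblem

variable {M : Type*}

/-- The histories that can arise. -/
inductive Reachable (P : SearchProblem M) : History M → Prop where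
  | nil : Reachable P []
  | snoc {h : History M} {k : M} (x : ℝ) (hh : Reachable P h) (hk : k ∈ P.inspectable h) :
      Reachable P (h ++ [(k, x)])

/-- The choice set after a history. -/
def choices (P : SearchProblem M) (h : History M) : Set (SearchAction M) :=
  {a | match a with
    | .inspect k => k ∈ P.inspectable h
    | .purchase k => k ∈ P.purchasable h}

/-- **Independence**: inspecting `m` does not change the belief about any other product that is
still to be inspected. -/
def Independence (P : SearchProblem M) : Prop :=
  ∀ h, P.Reachable h → ∀ m ∈ P.inspectable h, ∀ x : ℝ,
    ∀ k ∈ P.inspectable h, k ≠ m → P.belief (h ++ [(m, x)]) k = P.belief h k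

/-- **Invariance**: unselected inspections and purchases remain available, with identical
inspection costs and purchase utilities. -/
def Invariance (P : SearchProblem M) : Prop :=
  ∀ h, P.Reachable h → ∀ m ∈ P.inspectable h, ∀ x : ℝ,
    (∀ k ∈ P.inspectable h, k ≠ m →
      k ∈ P.inspectable (h ++ [(m, x)]) ∧ P.cost (h ++ [(m, x)]) k = P.cost h k) ∧
    (∀ k ∈ P.purchasable h,
      k ∈ P.purchasable (h ++ [(m, x)]) ∧ P.utility (h ++ [(m, x)]) k = P.utility h k)

/-- The expected payoff of taking an action after history `h`, when `V` gives the payoff of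
continuing. A purchase ends the search. -/
noncomputable def payoff (P : SearchProblem M) (V : History M → ℝ) (h : History M) :
    SearchAction M → ℝ
  | .inspect k => -P.cost h k + ∫ x, V (h ++ [(k, x)]) ∂(P.belief h k)
  | .purchase k => P.utility h k

/-- `V` solves the Bellman equation: at every history that can arise, `V` is the maximum of the
expected payoffs of the available actions. (The search ends after finitely many steps, so `V` is
unique on these histories.) -/
def SolvesBellman (P : SearchProblem M) (V : History M → ℝ) : Prop :=
  ∀ h, P.Reachable h → IsGreatest (P.payoff V h '' P.choices h) (V h)

/-- `z` is the reservation value of a product with purchase-value distribution `F` and inspection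
cost `c`: the fallback utility at which the expected gain from inspecting equals the cost. -/
def IsReservationValue (F : Measure ℝ) (c z : ℝ) : Prop :=
  c = ∫ u in Set.Ioi z, (u - z) ∂F

end SearchProblem

/-- A realized search process: the products inspected, in the order of inspection, followed by one
purchase. `value k` is the realized purchase value of `k` (latent if `k` is not inspected). -/
structure SearchProcess {M : Type*} (P : SearchProblem M) where
  inspected : List M
  purchased : M
  value : M → ℝ
  inspect_valid : ∀ (t : ℕ) (ht : t < inspected.length),
    inspected[t] ∈ P.inspectable ((inspected.take t).map fun k => (k, value k))
  purchase_valid : purchased ∈ P.purchasable (inspected.map fun k => (k, value k))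

namespace SearchProcess

variable {M : Type*} {P : SearchProblem M}

/-- The steps of the process: one for each inspection, and the purchase as the last one. -/
abbrev Step (p : SearchProcess P) := Fin (p.inspected.length + 1)

/-- The history at the beginning of a step. -/
def history (p : SearchProcess P) (t : p.Step) : History M :=
  (p.inspected.take t).map fun k => (k, p.value k)

/-- The action selected at a step. -/
def selected (p : SearchProcess P) (t : p.Step) : SearchAction M :=
  if ht : (t : ℕ) < p.inspected.length then .inspect p.inspected[(t : ℕ)]
  else .purchase p.purchased

/-- The process is optimal: every selected action attains the maximum in the Bellman equation. -/
def IsOptimal (p : SearchProcess P) : Prop :=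
  ∃ V : History M → ℝ, P.SolvesBellman V ∧
    ∀ t : p.Step, P.payoff V (p.history t) (p.selected t) = V (p.history t)

end SearchProcess

/-- The actions as they appear in the data: either identified as a particular inspection or
purchase, or only as the action that concerns product `k`, with unknown inspection status. -/
inductive ObsAction (M : Type*) where
  | identified (a : SearchAction M)
  | unidentified (k : M)

/-- The value of an action: the reservation value `z k` for inspecting `k`, the purchase value
`u k` for purchasing `k`, and the effective value `min (z k) (u k)` for the unidentified action
concerning `k`. -/
def ObsAction.value {M : Type*} (z u : M → ℝ) : ObsAction M → ℝ
  | .identified (.inspect k) => z k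
  | .identified (.purchase k) => u k
  | .unidentified k => min (z k) (u k)

/-- A possibly incomplete observation of a search process. -/
structure Observation {M : Type*} {P : SearchProblem M} (p : SearchProcess P) where
  /-- the steps whose selection is recorded in the data -/
  observed : Set p.Step
  /-- the products for which the data tell whether they have been inspected before the step;
  for the other products, the action available at the step is unidentified -/
  status : p.Step → Set M
  /-- a recorded inspection is identified as an inspection -/
  status_of_inspect : ∀ t ∈ observed, ∀ k, p.selected t = .inspect k → k ∈ status t

namespace Observation

variable {M : Type*} {P : SearchProblem M} {p : SearchProcess P}

open Classical in
/-- How an action appears in the data at step `t`. -/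
noncomputable def record (O : Observation p) (t : p.Step) (a : SearchAction M) : ObsAction M :=
  if a.product ∈ O.status t then .identified a else .unidentified a.product

/-- The choice set of step `t`, as it appears in the data. -/
def choiceSet (O : Observation p) (t : p.Step) : Set (ObsAction M) :=
  O.record t '' P.choices (p.history t)

/-- The action selected at step `t`, as it appears in the data. (A purchase of a product with
unidentified status at the last step appears as the unidentified action of that product, which
then stands for its inspection and purchase together.) -/
noncomputable def selected (O : Observation p) (t : p.Step) : ObsAction M :=
  O.record t (p.selected t)

/-- All observed actions that are available at some step of the process. -/
def available (O : Observation p) : Set (ObsAction M) :=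
  ⋃ t, O.choiceSet t

/-- The action is never selected in the process. The unidentified action of a product counts as
selected if and only if the product is purchased. -/
def Unselected (_O : Observation p) : ObsAction M → Prop
  | .identified a => ∀ t, p.selected t ≠ a
  | .unidentified k => k ≠ p.purchased

/-- Some unselected alternative in the choice set of step `t` is selected in a later observed
step. -/
def ForwardAccessible (O : Observation p) (t : p.Step) : Prop :=
  ∃ b ∈ O.choiceSet t, b ≠ O.selected t ∧ ∃ s ∈ O.observed, t < s ∧ O.selected s = b

/-- `y` is the core value: the minimum value among the actions selected in forward-inaccessible
observed steps. -/
def IsCoreValue (O : Observation p) (z : M → ℝ) (y : ℝ) : Prop :=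
  IsLeast {v | ∃ t ∈ O.observed, ¬ O.ForwardAccessible t ∧
    v = (O.selected t).value z p.value} y

end Observation

/-! The core is Weitzman's index rule, in a form that gives necessity. Cap the purchase value of
each uninspected product at `z k`; the optimal payoff after a history is the expected maximum of
these capped values and the revealed utilities (`expectedMax`). For an inspection, the cost may be
replaced by the random charge `max (x - z k) 0`, which has the same mean by definition of `z k`. The
loss from any action then becomes the mean of a nonnegative random variable, which vanishes almost
surely exactly when the action has the highest index (`payoff_inspect`, `payoff_purchase`). Backward
induction (`SolvesBellman.eq_expectedMax`) turns optimality into the ranking `IsRanked`.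

What remains is combinatorics on the realized path. An inspected product that is not purchased has
value at most its own `z k`; hence the remaining action of an unpurchased product lies below every
inspection made, below the purchase, and so below the effective value of the purchased product.
Incomplete data replace alternatives by minima, which only lowers them, while a recorded inspection
keeps its full value, so the comparisons survive. -/

/-- Resampling one coordinate of a random vector with independent coordinates preserves its
distribution. -/
theorem measurePreserving_update_pi {M : Type*} [Fintype M] [DecidableEq M]
    (F : M → Measure ℝ) [∀ k, IsProbabilityMeasure (F k)] (k : M) :
    MeasurePreserving (fun q : ℝ × (M → ℝ) => Function.update q.2 k q.1)
      ((F k).prod (Measure.pi F)) (Measure.pi F) := by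
  have hm : Measurable (fun q : ℝ × (M → ℝ) => Function.update q.2 k q.1) := by
    refine measurable_pi_lambda _ fun j => ?_
    by_cases h : j = k
    · subst h; simpa using measurable_fst
    · simp only [Function.update_of_ne h]
      exact (measurable_pi_apply j).comp measurable_snd
  refine ⟨hm, (Measure.pi_eq fun s hs => ?_).symm⟩
  have hpre : (fun q : ℝ × (M → ℝ) => Function.update q.2 k q.1) ⁻¹' Set.univ.pi s
      = s k ×ˢ Set.univ.pi (Function.update s k Set.univ) := by
    ext ⟨x, w⟩
    simp only [Set.mem_preimage, Set.mem_pi, Set.mem_univ, true_implies, Set.mem_prod]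
    constructor
    · intro h
      refine ⟨by simpa using h k, fun j => ?_⟩
      by_cases hj : j = k
      · subst hj; simp
      · simpa [Function.update_of_ne hj] using h j
    · rintro ⟨h0, h⟩ j
      by_cases hj : j = k
      · subst hj; simpa using h0
      · simpa [Function.update_of_ne hj] using h j
  rw [Measure.map_apply hm (MeasurableSet.univ_pi hs), hpre, Measure.prod_prod, Measure.pi_pi,
    ← Finset.mul_prod_erase Finset.univ _ (Finset.mem_univ k),
    ← Finset.mul_prod_erase Finset.univ (fun i => F i (s i)) (Finset.mem_univ k)]
  simp only [Function.update_self, measure_univ, one_mul]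
  congr 1
  exact Finset.prod_congr rfl fun j hj => by rw [Function.update_of_ne (Finset.ne_of_mem_erase hj)]

theorem integrable_iSup_of_finite {α ι : Type*} [MeasurableSpace α] {μ : Measure α} [Finite ι]
    [Nonempty ι] {f : ι → α → ℝ} (hm : ∀ i, Measurable (f i)) (hf : ∀ i, Integrable (f i) μ) :
    Integrable (fun x => ⨆ i, f i x) μ := by
  have := Fintype.ofFinite ι
  refine (integrable_finsetSum Finset.univ fun i _ => (hf i).abs).mono'
    (Measurable.iSup hm).aestronglyMeasurable (Filter.Eventually.of_forall fun x => ?_)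
  obtain ⟨i, hi⟩ := exists_eq_ciSup_of_finite (f := fun i => f i x)
  rw [← hi, Real.norm_eq_abs]
  exact Finset.single_le_sum (f := fun i => |f i x|) (fun _ _ => abs_nonneg _) (Finset.mem_univ i)

/-! ### Reservation values -/

section Reservation

variable {F : Measure ℝ} {c z : ℝ}

theorem SearchProblem.IsReservationValue.eq_integral_max
    (h : SearchProblem.IsReservationValue F c z) : c = ∫ u, max (u - z) 0 ∂F := by
  rw [h, ← integral_indicator measurableSet_Ioi]
  refine integral_congr_ae (Filter.Eventually.of_forall fun u => ?_)
  by_cases hu : z < u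
  · simp [Set.indicator, hu, max_eq_left (sub_nonneg.2 hu.le)]
  · simp [Set.indicator, hu, max_eq_right (sub_nonpos.2 (not_lt.1 hu))]

/-- A positive cost cannot be recovered by an integral over a null set. This positivity is the
source of all strictness in the index rule. -/
theorem SearchProblem.IsReservationValue.measure_Ioi_pos
    (h : SearchProblem.IsReservationValue F c z) (hc : 0 < c) : 0 < F (Set.Ioi z) := by
  refine pos_iff_ne_zero.2 fun h0 => hc.ne' ?_
  rw [h, Measure.restrict_eq_zero.2 h0, integral_zero_measure]

end Reservation

/-! ### Pathwise loss from an inspection: capped vector `a`, revealed vector `b` -/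

section Gap

variable {M : Type*} [Finite M] {a b : M → ℝ} {k : M} {x z : ℝ}

/-- Replacing the capped value `min x z` by `x` raises the maximum by at most `max (x - z) 0`. -/
theorem iSup_sub_le_iSup_of_capped (ha : a k = min x z) (hb : b k = x)
    (h : ∀ j, j ≠ k → b j = a j) :
    (⨆ j, b j) - max (x - z) 0 ≤ ⨆ j, a j := by
  have : Nonempty M := ⟨k⟩
  obtain ⟨i, hi⟩ := exists_eq_ciSup_of_finite (f := b)
  have hle := le_ciSup (Set.finite_range a).bddAbove i
  rw [← hi]
  by_cases hik : i = k
  · subst hik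
    rw [ha] at hle
    rw [hb]
    rcases le_total x z with hx | hx
    · rw [min_eq_left hx] at hle; rw [max_eq_right (by linarith)]; linarith
    · rw [min_eq_right hx] at hle; rw [max_eq_left (by linarith)]; linarith
  · rw [h i hik]
    linarith [le_max_right (x - z) 0]

/-- If `z` dominates every entry, the charge is exactly the amount cut off by the cap, so the
inspection loses nothing. -/
theorem iSup_le_iSup_sub_of_capped (ha : a k = min x z) (hb : b k = x)
    (h : ∀ j, j ≠ k → b j = a j) (hz : ∀ j, a j ≤ z) :
    ⨆ j, a j ≤ (⨆ j, b j) - max (x - z) 0 := by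
  have : Nonempty M := ⟨k⟩
  refine ciSup_le fun j => ?_
  have hB := (Set.finite_range b).bddAbove
  rcases le_total x z with hx | hx
  · rw [max_eq_right (by linarith), sub_zero]
    refine le_trans (le_of_eq ?_) (le_ciSup hB j)
    by_cases hj : j = k
    · rw [hj, ha, hb, min_eq_left hx]
    · exact (h j hj).symm
  · rw [max_eq_left (by linarith)]
    have := le_ciSup hB k
    rw [hb] at this
    linarith [hz j]

/-- With an alternative above `z`, a draw `x > z` is charged `x - z` in full but improves on the
capped maximum by less. -/
theorem iSup_sub_lt_iSup_of_capped (hb : b k = x)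
    (h : ∀ j, j ≠ k → b j = a j) (hx : z < x) {j : M} (hj : z < a j) :
    (⨆ j, b j) - max (x - z) 0 < ⨆ j, a j := by
  have : Nonempty M := ⟨k⟩
  have hA := (Set.finite_range a).bddAbove
  obtain ⟨i, hi⟩ := exists_eq_ciSup_of_finite (f := b)
  rw [← hi, max_eq_left (by linarith)]
  by_cases hik : i = k
  · rw [hik, hb]; linarith [le_ciSup hA j]
  · rw [h i hik]; linarith [le_ciSup hA i]

end Gap

/-! ### Histories, indices and effective values -/

namespace SearchProblem

variable {M : Type*} {P : SearchProblem M}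

theorem not_mem_inspectable_of_purchasable {h : History M} {k : M} (hk : k ∈ P.purchasable h) :
    k ∉ P.inspectable h := fun hi =>
  let ⟨x, hx⟩ := P.inspected_of_purchasable h k hk
  P.not_inspected h k hi x hx

theorem not_mem_inspectable_append (h : History M) (k : M) (x : ℝ) :
    k ∉ P.inspectable (h ++ [(k, x)]) := fun hi => P.not_inspected _ k hi x (by simp)

/-- Together with `not_mem_inspectable_of_purchasable`, each product offers exactly one action, so
actions can be indexed by products. -/
theorem Reachable.inspectable_or_purchasable (hInv : P.Invariance) {h : History M}
    (hr : P.Reachable h) (k : M) : k ∈ P.inspectable h ∨ k ∈ P.purchasable h := by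
  induction hr with
  | nil => exact .inl (P.inspectable_nil k)
  | @snoc h m x hh hm ih =>
    by_cases hkm : k = m
    · subst hkm; exact .inr (P.purchasable_reveal h k x hm)
    · exact ih.imp (fun hk => ((hInv h hh m hm x).1 k hk hkm).1)
        fun hk => ((hInv h hh m hm x).2 k hk).1

theorem Reachable.mem_inspectable_append (hInv : P.Invariance) {h : History M}
    (hr : P.Reachable h) {m : M} (hm : m ∈ P.inspectable h) (x : ℝ) (k : M) :
    k ∈ P.inspectable (h ++ [(m, x)]) ↔ k ∈ P.inspectable h ∧ k ≠ m := by
  refine ⟨fun hk => ⟨?_, ?_⟩, fun hk => ((hInv h hr m hm x).1 k hk.1 hk.2).1⟩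
  · refine (hr.inspectable_or_purchasable hInv k).resolve_right fun hp => ?_
    exact not_mem_inspectable_of_purchasable ((hInv h hr m hm x).2 k hp).1 hk
  · rintro rfl
    exact not_mem_inspectable_append h k x hk

theorem Reachable.belief_and_cost_eq (hInd : P.Independence) (hInv : P.Invariance)
    {h : History M} (hr : P.Reachable h) {k : M} (hk : k ∈ P.inspectable h) :
    P.belief h k = P.belief [] k ∧ P.cost h k = P.cost [] k := by
  induction hr with
  | nil => exact ⟨rfl, rfl⟩
  | @snoc h m x hh hm ih =>
    obtain ⟨hk', hkm⟩ := (hh.mem_inspectable_append hInv hm x k).1 hk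
    rw [hInd h hh m hm x k hk' hkm, ((hInv h hh m hm x).1 k hk' hkm).2]
    exact ih hk'

open Classical in
/-- The value of the action that concerns product `k` after a history. -/
noncomputable def index (P : SearchProblem M) (z : M → ℝ) (h : History M) (k : M) : ℝ :=
  if k ∈ P.inspectable h then z k else P.utility h k

open Classical in
/-- The effective value of product `k` after a history, when `w` lists the purchase values of the
products that are still to be inspected. -/
noncomputable def effective (P : SearchProblem M) (z : M → ℝ) (h : History M) (w : M → ℝ)
    (k : M) : ℝ :=
  if k ∈ P.inspectable h then min (w k) (z k) else P.utility h k

variable {z : M → ℝ}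

theorem effective_le_index (h : History M) (w : M → ℝ) (k : M) :
    P.effective z h w k ≤ P.index z h k := by
  unfold effective index
  split_ifs
  · exact min_le_right _ _
  · exact le_rfl

theorem index_product_of_mem_choices {h : History M} {a : SearchAction M} (ha : a ∈ P.choices h) :
    P.index z h a.product = match a with
      | .inspect k => z k
      | .purchase k => P.utility h k := by
  cases a with
  | inspect k => exact if_pos ha
  | purchase k => exact if_neg (not_mem_inspectable_of_purchasable ha)

theorem measurable_effective (h : History M) (k : M) :
    Measurable fun w => P.effective z h w k := by
  unfold effective
  split_ifs
  · exact (measurable_pi_apply k).min measurable_const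
  · exact measurable_const

theorem effective_append {h : History M} {k : M} (hk : k ∈ P.inspectable h) (x : ℝ) (w : M → ℝ) :
    P.effective z (h ++ [(k, x)]) w k = x := by
  simp [effective, not_mem_inspectable_append h k x, P.utility_reveal h k x hk]

theorem Reachable.effective_append_of_ne [DecidableEq M] (hInv : P.Invariance) {h : History M}
    (hr : P.Reachable h) {k : M} (hk : k ∈ P.inspectable h) (x : ℝ) (w : M → ℝ) {j : M}
    (hj : j ≠ k) :
    P.effective z (h ++ [(k, x)]) w j = P.effective z h (Function.update w k x) j := by
  unfold effective
  rw [hr.mem_inspectable_append hInv hk, Function.update_of_ne hj]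
  by_cases hji : j ∈ P.inspectable h
  · simp [hji, hj]
  · have hp := (hr.inspectable_or_purchasable hInv j).resolve_left hji
    simp [hji, ((hInv h hr k hk x).2 j hp).2]

theorem effective_update [DecidableEq M] {h : History M} {k : M} (hk : k ∈ P.inspectable h)
    (x : ℝ) (w : M → ℝ) : P.effective z h (Function.update w k x) k = min x (z k) := by
  simp [effective, hk]

/-! ### The index rule: optimal payoff and optimal actions -/

section Gittins

variable [Fintype M]

/-- The distribution of the purchase values. -/
noncomputable def valueLaw (P : SearchProblem M) : Measure (M → ℝ) := Measure.pi (P.belief [])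

instance : IsProbabilityMeasure P.valueLaw :=
  have := P.belief_prob []
  inferInstanceAs (IsProbabilityMeasure (Measure.pi (P.belief [])))

/-- The expected maximum of the effective values. -/
noncomputable def expectedMax (P : SearchProblem M) (z : M → ℝ) (h : History M) : ℝ :=
  ∫ w, ⨆ k, P.effective z h w k ∂P.valueLaw

theorem integrable_effective (h : History M) (k : M) :
    Integrable (fun w => P.effective z h w k) P.valueLaw := by
  have := P.belief_prob []
  unfold effective
  split_ifs
  · exact (integrable_comp_eval (μ := P.belief []) (i := k) (f := fun x : ℝ => x)
      (P.belief_integrable [] k)).inf (integrable_const _)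
  · exact integrable_const _

theorem integrable_iSup_effective [Nonempty M] (h : History M) :
    Integrable (fun w => ⨆ k, P.effective z h w k) P.valueLaw :=
  integrable_iSup_of_finite (measurable_effective h) (integrable_effective h)

/-- The cap binds whenever the draw exceeds `z k`, which has positive probability; a revealed
product attains its index surely. -/
theorem measure_effective_eq_index_pos
    (hz : ∀ k, IsReservationValue (P.belief [] k) (P.cost [] k) (z k)) (h : History M) (k : M) :
    0 < P.valueLaw {w | P.effective z h w k = P.index z h k} := by
  have := P.belief_prob []
  by_cases hk : k ∈ P.inspectable h
  · refine ((hz k).measure_Ioi_pos (P.cost_pos _ _)).trans_le ?_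
    rw [← (measurePreserving_eval (P.belief []) k).measure_preimage
      measurableSet_Ioi.nullMeasurableSet]
    refine measure_mono fun w hw => ?_
    simp only [Set.mem_ofPred_eq, effective, index, hk, if_true]
    exact min_eq_right (le_of_lt hw)
  · simp [effective, index, hk]

/-- Drawing coordinate `k` separately from the rest puts the situations before and after the
inspection on one probability space, where they can be compared pointwise. -/
theorem Reachable.payoff_inspect [Nonempty M] (hInd : P.Independence) (hInv : P.Invariance)
    (hz : ∀ k, IsReservationValue (P.belief [] k) (P.cost [] k) (z k))
    {V : History M → ℝ} {h : History M} (hr : P.Reachable h) {k : M} (hk : k ∈ P.inspectable h)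
    (hV : ∀ x, V (h ++ [(k, x)]) = P.expectedMax z (h ++ [(k, x)])) :
    P.payoff V h (.inspect k) ≤ P.expectedMax z h ∧
      (P.payoff V h (.inspect k) = P.expectedMax z h ↔ ∀ j, P.index z h j ≤ z k) := by
  classical
  have := P.belief_prob []
  obtain ⟨hB, hC⟩ := hr.belief_and_cost_eq hInd hInv hk
  set F := P.belief [] k with hF
  set ν := F.prod P.valueLaw with hν
  set A : ℝ × (M → ℝ) → ℝ := fun q => ⨆ j, P.effective z h (Function.update q.2 k q.1) j with hA
  set B : ℝ × (M → ℝ) → ℝ := fun q => ⨆ j, P.effective z (h ++ [(k, q.1)]) q.2 j with hBdef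
  set C : ℝ × (M → ℝ) → ℝ := fun q => max (q.1 - z k) 0 with hCdef
  have hmp := measurePreserving_update_pi (P.belief []) k
  have hAint : Integrable A ν := hmp.integrable_comp_of_integrable (integrable_iSup_effective h)
  have hAeq : ∫ q, A q ∂ν = P.expectedMax z h := by
    rw [expectedMax, valueLaw, ← hmp.map_eq, integral_map hmp.measurable.aemeasurable]
    · rfl
    · rw [hmp.map_eq]; exact (integrable_iSup_effective (P := P) (z := z) h).aestronglyMeasurable
  have hidF : Integrable (fun x : ℝ => x) F := P.belief_integrable [] k
  have hBint : Integrable B ν := by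
    -- The history itself varies with the draw, so joint measurability is obtained coordinate by
    -- coordinate from the state before the inspection.
    have key : ∀ j, (fun q : ℝ × (M → ℝ) => P.effective z (h ++ [(k, q.1)]) q.2 j) =
        if j = k then fun q => q.1 else fun q => P.effective z h (Function.update q.2 k q.1) j := by
      intro j
      split_ifs with hj
      · subst hj; exact funext fun q => effective_append hk _ _
      · exact funext fun q => hr.effective_append_of_ne hInv hk _ _ hj
    refine integrable_iSup_of_finite (fun j => ?_) fun j => ?_ <;> rw [key] <;> split_ifs
    · exact measurable_fst
    · exact (measurable_effective h j).comp hmp.measurable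
    · exact hidF.comp_fst _
    · exact hmp.integrable_comp_of_integrable (integrable_effective h j)
  have hCint : Integrable C ν :=
    Integrable.comp_fst (f := fun x => max (x - z k) 0)
      ((hidF.sub (integrable_const (z k))).sup (integrable_const 0)) _
  have hBeq : ∫ q, B q ∂ν = ∫ x, V (h ++ [(k, x)]) ∂F := by
    rw [hν, integral_prod B hBint]
    simp only [hV]; rfl
  have hCeq : ∫ q, C q ∂ν = P.cost h k := by
    rw [hC, (hz k).eq_integral_max, hν, integral_prod C hCint]
    simp [hCdef, hF]
  -- `D` is the pathwise loss from inspecting `k`; its mean is the gap between `expectedMax` and the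
  -- payoff.
  set D : ℝ × (M → ℝ) → ℝ := fun q => A q - (B q - C q) with hD
  have hD0 : 0 ≤ D := fun q => sub_nonneg.2 <|
    iSup_sub_le_iSup_of_capped (effective_update hk _ _) (effective_append hk _ _)
      fun j hj => hr.effective_append_of_ne hInv hk _ _ hj
  have hDint : Integrable D ν := hAint.sub (hBint.sub hCint)
  have hDeq : ∫ q, D q ∂ν = P.expectedMax z h - P.payoff V h (.inspect k) := by
    have h1 : ∫ q, D q ∂ν = ∫ q, A q ∂ν - ∫ q, (B - C) q ∂ν := integral_sub hAint (hBint.sub hCint)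
    rw [h1, integral_sub' hBint hCint, hAeq, hBeq, hCeq,
      payoff, hB]
    ring
  refine ⟨sub_nonneg.1 (hDeq ▸ integral_nonneg hD0), ?_⟩
  rw [eq_comm, ← sub_eq_zero, ← hDeq, integral_eq_zero_iff_of_nonneg hD0 hDint]
  constructor
  · intro hae
    by_contra! hj
    obtain ⟨j, hj⟩ := hj
    -- If `j` has a higher index than `k`, the independent events that the draw of `k` exceeds `z k`
    -- and that `j` attains its index jointly have positive probability, and there `D` is strictly
    -- positive.
    have hpos : 0 < ν (Set.Ioi (z k) ×ˢ {w | P.effective z h w j = P.index z h j}) := by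
      rw [hν, Measure.prod_prod]
      exact ENNReal.mul_pos ((hz k).measure_Ioi_pos (P.cost_pos _ _)).ne'
        (measure_effective_eq_index_pos hz h j).ne'
    refine hpos.ne' (measure_mono_null ?_ (ae_iff.1 hae))
    rintro ⟨x, w⟩ ⟨hx, hw⟩
    have hjk : j ≠ k := by
      rintro rfl
      simp [index, hk] at hj
    refine ne_of_gt (sub_pos.2 ?_)
    refine iSup_sub_lt_iSup_of_capped (j := j) (effective_append hk _ _)
      (fun j hj => hr.effective_append_of_ne hInv hk _ _ hj) hx ?_
    have : P.effective z h (Function.update w k x) j = P.effective z h w j := by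
      simp [effective, Function.update_of_ne hjk]
    rw [this, show P.effective z h w j = _ from hw]
    exact hj
  · intro hmax
    refine Filter.Eventually.of_forall fun q => le_antisymm (sub_nonpos.2 ?_) (hD0 q)
    exact iSup_le_iSup_sub_of_capped (effective_update hk _ _) (effective_append hk _ _)
      (fun j hj => hr.effective_append_of_ne hInv hk _ _ hj)
      fun j => (effective_le_index h _ j).trans (hmax j)

theorem payoff_purchase [Nonempty M]
    (hz : ∀ k, IsReservationValue (P.belief [] k) (P.cost [] k) (z k))
    (V : History M → ℝ) {h : History M} {k : M} (hk : k ∈ P.purchasable h) :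
    P.payoff V h (.purchase k) ≤ P.expectedMax z h ∧
      (P.payoff V h (.purchase k) = P.expectedMax z h ↔
        ∀ j, P.index z h j ≤ P.utility h k) := by
  have hki := not_mem_inspectable_of_purchasable hk
  have hbdd := fun w => (Set.finite_range (P.effective z h w)).bddAbove
  have heff : ∀ w, P.effective z h w k = P.utility h k := fun w => by simp [effective, hki]
  set D : (M → ℝ) → ℝ := fun w => (⨆ j, P.effective z h w j) - P.utility h k with hD
  have hD0 : 0 ≤ D := fun w => sub_nonneg.2 (heff w ▸ le_ciSup (hbdd w) k)
  have hDint : Integrable D P.valueLaw := (integrable_iSup_effective h).sub (integrable_const _)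
  have hDeq : ∫ w, D w ∂P.valueLaw = P.expectedMax z h - P.payoff V h (.purchase k) := by
    rw [hD, integral_sub (integrable_iSup_effective h) (integrable_const _)]
    simp [payoff, expectedMax]
  refine ⟨sub_nonneg.1 (hDeq ▸ integral_nonneg hD0), ?_⟩
  rw [eq_comm, ← sub_eq_zero, ← hDeq, integral_eq_zero_iff_of_nonneg hD0 hDint]
  constructor
  · intro hae
    by_contra! hj
    obtain ⟨j, hj⟩ := hj
    refine (measure_effective_eq_index_pos hz h j).ne' (measure_mono_null ?_ (ae_iff.1 hae))
    intro w hw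
    refine ne_of_gt (sub_pos.2 (hj.trans_le ?_))
    rw [← show P.effective z h w j = _ from hw]
    exact le_ciSup (hbdd w) j
  · intro hmax
    exact Filter.Eventually.of_forall fun w => le_antisymm
      (sub_nonpos.2 (ciSup_le fun j => (effective_le_index h w j).trans (hmax j))) (hD0 w)

theorem SolvesBellman.eq_expectedMax [Nonempty M] (hInd : P.Independence) (hInv : P.Invariance)
    (hz : ∀ k, IsReservationValue (P.belief [] k) (P.cost [] k) (z k))
    {V : History M → ℝ} (hV : P.SolvesBellman V) {h : History M} (hr : P.Reachable h) :
    V h = P.expectedMax z h ∧ ∀ a ∈ P.choices h,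
      P.payoff V h a = P.expectedMax z h ↔ ∀ j, P.index z h j ≤ P.index z h a.product := by
  -- Backward induction: each inspection removes one product from the inspectable set.
  induction hn : (P.inspectable h).ncard using Nat.strong_induction_on generalizing h with
  | _ n ih =>
  have hnext : ∀ k ∈ P.inspectable h, ∀ x, V (h ++ [(k, x)]) = P.expectedMax z (h ++ [(k, x)]) := by
    intro k hk x
    refine (ih _ ?_ (hr.snoc x hk) rfl).1
    rw [← hn]
    refine Set.ncard_lt_ncard ⟨fun j hj => ((hr.mem_inspectable_append hInv hk x j).1 hj).1, ?_⟩
    exact fun hsub => not_mem_inspectable_append h k x (hsub hk)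
  have hact : ∀ a ∈ P.choices h, P.payoff V h a ≤ P.expectedMax z h ∧
      (P.payoff V h a = P.expectedMax z h ↔
        ∀ j, P.index z h j ≤ P.index z h a.product) := by
    intro a ha
    rw [index_product_of_mem_choices ha]
    cases a with
    | inspect k => exact hr.payoff_inspect hInd hInv hz ha (hnext k ha)
    | purchase k => exact payoff_purchase hz V ha
  refine ⟨?_, fun a ha => (hact a ha).2⟩
  obtain ⟨⟨a, ha, hVa⟩, hub⟩ := hV h hr
  refine le_antisymm (hVa ▸ (hact a ha).1) ?_
  -- The product of highest index offers some action, which attains the upper bound.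
  obtain ⟨k, hk⟩ := Finite.exists_max (P.index z h)
  obtain ⟨b, hb, hbk⟩ : ∃ b ∈ P.choices h, b.product = k := by
    rcases hr.inspectable_or_purchasable hInv k with hk | hk
    · exact ⟨.inspect k, hk, rfl⟩
    · exact ⟨.purchase k, hk, rfl⟩
  rw [← ((hact b hb).2).2 (hbk ▸ hk)]
  exact hub ⟨b, hb, rfl⟩

/-- An action that attains the maximum in the Bellman equation has the highest value among the
available actions. -/
theorem SolvesBellman.index_le [Nonempty M] (hInd : P.Independence) (hInv : P.Invariance)
    (hz : ∀ k, IsReservationValue (P.belief [] k) (P.cost [] k) (z k))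
    {V : History M → ℝ} (hV : P.SolvesBellman V) {h : History M} (hr : P.Reachable h)
    {a : SearchAction M} (ha : a ∈ P.choices h) (hopt : P.payoff V h a = V h) (j : M) :
    P.index z h j ≤ P.index z h a.product := by
  obtain ⟨h1, h2⟩ := hV.eq_expectedMax hInd hInv hz hr
  exact (h2 a ha).1 (hopt.trans h1) j

end Gittins

end SearchProblem

/-! ### Ranking along the realized search path -/

theorem SearchProblem.Reachable.utility_eq {M : Type*} {P : SearchProblem M} (hInv : P.Invariance)
    {h : History M} (hr : P.Reachable h) {k : M} {x : ℝ} (hk : (k, x) ∈ h) :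
    P.utility h k = x := by
  induction hr with
  | nil => simp at hk
  | @snoc h m y hh hm ih =>
    rcases List.mem_append.1 hk with hk | hk
    · have hkp := (hh.inspectable_or_purchasable hInv k).resolve_left
        fun hi => P.not_inspected h k hi x hk
      rw [((hInv h hh m hm y).2 k hkp).2, ih hk]
    · obtain ⟨rfl, rfl⟩ : k = m ∧ x = y := by simpa using hk
      exact P.utility_reveal h k x hm

namespace SearchProcess

variable {M : Type*} {P : SearchProblem M} (p : SearchProcess P)

theorem reachable_history (t : p.Step) : P.Reachable (p.history t) := by
  obtain ⟨t, ht⟩ := t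
  induction t with
  | zero => simpa [history] using SearchProblem.Reachable.nil
  | succ t ih =>
    have hlt : t < p.inspected.length := by omega
    have := (ih (by omega)).snoc (p.value p.inspected[t]) (p.inspect_valid t hlt)
    simpa only [history, ← List.take_append_getElem hlt, List.map_append, List.map_cons,
      List.map_nil] using this

theorem mem_inspectable_history (hInv : P.Invariance) (t : p.Step) (k : M) :
    k ∈ P.inspectable (p.history t) ↔ k ∉ p.inspected.take t := by
  constructor
  · intro hk hm
    exact P.not_inspected _ k hk (p.value k) (List.mem_map.2 ⟨k, hm, rfl⟩)
  · intro hk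
    refine ((p.reachable_history t).inspectable_or_purchasable hInv k).resolve_right fun hp => ?_
    obtain ⟨x, hx⟩ := P.inspected_of_purchasable _ k hp
    obtain ⟨m, hm, he⟩ := List.mem_map.1 hx
    exact hk ((Prod.mk.inj he).1 ▸ hm)

theorem mem_purchasable_history (hInv : P.Invariance) (t : p.Step) (k : M) :
    k ∈ P.purchasable (p.history t) ↔ k ∈ p.inspected.take t := by
  rw [← not_iff_not, ← p.mem_inspectable_history hInv]
  have := (p.reachable_history t).inspectable_or_purchasable hInv k
  have := SearchProblem.not_mem_inspectable_of_purchasable (P := P) (h := p.history t) (k := k)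
  tauto

theorem selected_of_lt {t : p.Step} (ht : (t : ℕ) < p.inspected.length) :
    p.selected t = .inspect p.inspected[(t : ℕ)] := dif_pos ht

theorem selected_last : p.selected (Fin.last _) = .purchase p.purchased := by
  simp [selected]

theorem selected_mem_choices (t : p.Step) : p.selected t ∈ P.choices (p.history t) := by
  rcases t.eq_castSucc_or_eq_last with ⟨i, rfl⟩ | rfl
  · rw [p.selected_of_lt (t := i.castSucc) i.isLt]
    exact p.inspect_valid i i.isLt
  · rw [selected_last]
    show p.purchased ∈ P.purchasable _
    simpa [history] using p.purchase_valid

theorem not_mem_take {t : ℕ} (ht : t < p.inspected.length) :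
    p.inspected[t] ∉ p.inspected.take t := fun hm =>
  P.not_inspected _ _ (p.inspect_valid t ht) (p.value p.inspected[t])
    (List.mem_map.2 ⟨_, hm, rfl⟩)

theorem purchased_mem : p.purchased ∈ p.inspected := by
  obtain ⟨x, hx⟩ := P.inspected_of_purchasable _ _ p.purchase_valid
  obtain ⟨m, hm, he⟩ := List.mem_map.1 hx
  exact (Prod.mk.inj he).1 ▸ hm

open Classical in
theorem index_history (hInv : P.Invariance) (z : M → ℝ) (t : p.Step) (k : M) :
    P.index z (p.history t) k = if k ∈ p.inspected.take t then p.value k else z k := by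
  rw [SearchProblem.index, p.mem_inspectable_history hInv]
  by_cases hk : k ∈ p.inspected.take t
  · rw [if_neg (not_not_intro hk), if_pos hk]
    exact (p.reachable_history t).utility_eq hInv (List.mem_map.2 ⟨k, hk, rfl⟩)
  · rw [if_pos hk, if_neg hk]

/-- Every selected action has the highest value among the available actions. -/
def IsRanked (z : M → ℝ) : Prop :=
  ∀ t : p.Step, ∀ k, P.index z (p.history t) k ≤ P.index z (p.history t) (p.selected t).product

theorem IsOptimal.isRanked [Finite M] {p : SearchProcess P} (hopt : p.IsOptimal)
    (hInd : P.Independence) (hInv : P.Invariance) {z : M → ℝ}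
    (hz : ∀ k, SearchProblem.IsReservationValue (P.belief [] k) (P.cost [] k) (z k)) :
    p.IsRanked z := by
  have := Fintype.ofFinite M
  have : Nonempty M := ⟨p.purchased⟩
  obtain ⟨V, hV, hsel⟩ := hopt
  exact fun t k => hV.index_le hInd hInv hz (p.reachable_history t) (p.selected_mem_choices t)
    (hsel t) k

variable {p} {z : M → ℝ}

theorem IsRanked.index_le_getElem (hp : p.IsRanked z) (hInv : P.Invariance) {t : ℕ}
    (ht : t < p.inspected.length) (k : M) :
    P.index z (p.history ⟨t, by omega⟩) k ≤ z p.inspected[t] := by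
  have := hp ⟨t, by omega⟩ k
  rwa [p.selected_of_lt (t := ⟨t, by omega⟩) ht,
    p.index_history hInv z _ (SearchAction.product _),
    if_neg (by exact p.not_mem_take ht)] at this

theorem IsRanked.le_of_not_mem_take (hp : p.IsRanked z) (hInv : P.Invariance) {t : ℕ}
    (ht : t < p.inspected.length) {k : M} (hk : k ∉ p.inspected.take t) :
    z k ≤ z p.inspected[t] := by
  have := hp.index_le_getElem hInv ht k
  rwa [p.index_history hInv, if_neg hk] at this

theorem IsRanked.value_le_of_mem_take (hp : p.IsRanked z) (hInv : P.Invariance) {t : ℕ}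
    (ht : t < p.inspected.length) {k : M} (hk : k ∈ p.inspected.take t) :
    p.value k ≤ z p.inspected[t] := by
  have := hp.index_le_getElem hInv ht k
  rwa [p.index_history hInv, if_pos hk] at this

open Classical in
theorem IsRanked.le_value_purchased (hp : p.IsRanked z) (hInv : P.Invariance) (k : M) :
    (if k ∈ p.inspected then p.value k else z k) ≤ p.value p.purchased := by
  have := hp (Fin.last _) k
  rw [selected_last, p.index_history hInv, p.index_history hInv z _ (SearchAction.product _)] at this
  simpa [SearchAction.product, p.purchased_mem] using this

/-- An inspected product that is not purchased turns out no better than its reservation value. -/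
theorem IsRanked.value_le_of_ne_purchased (hp : p.IsRanked z) (hInv : P.Invariance) {k : M}
    (hk : k ∈ p.inspected) (hne : k ≠ p.purchased) : p.value k ≤ z k := by
  obtain ⟨i, hi, rfl⟩ := List.mem_iff_getElem.1 hk
  -- If another inspection follows `k`, its reservation value lies between `value k` and `z k`. If
  -- `k` is inspected last, the purchased product was already available then, and its value lies in
  -- between.
  rcases Nat.lt_or_ge (i + 1) p.inspected.length with hi' | hi'
  · refine (hp.value_le_of_mem_take hInv hi' (List.mem_take_iff_getElem.2 ⟨i, by omega, rfl⟩)).trans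
      (hp.le_of_not_mem_take hInv hi fun hm => p.not_mem_take hi' ?_)
    exact List.take_subset_take_left _ (Nat.le_succ i) hm
  · have hle := hp.le_value_purchased hInv p.inspected[i]
    rw [if_pos hk] at hle
    refine hle.trans (hp.value_le_of_mem_take hInv hi ?_)
    obtain ⟨m, hm, hmp⟩ := List.mem_iff_getElem.1 p.purchased_mem
    have hmi : m ≠ i := by rintro rfl; exact hne hmp
    exact List.mem_take_iff_getElem.2 ⟨m, by omega, hmp⟩

open Classical in
/-- The remaining action of a product that is not purchased is valued no higher than the inspection
of any inspected product. -/
theorem IsRanked.le_of_mem_inspected (hp : p.IsRanked z) (hInv : P.Invariance) {k m : M}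
    (hne : k ≠ p.purchased) (hm : m ∈ p.inspected) :
    (if k ∈ p.inspected then p.value k else z k) ≤ z m := by
  obtain ⟨i, hi, rfl⟩ := List.mem_iff_getElem.1 hm
  -- If `k` is not yet inspected when `m` is selected, its remaining action is worth at most `z k`,
  -- hence at most `z m`.
  by_cases hki : k ∈ p.inspected.take i
  · rw [if_pos (List.mem_of_mem_take hki)]
    exact hp.value_le_of_mem_take hInv hi hki
  · refine le_trans ?_ (hp.le_of_not_mem_take hInv hi hki)
    split_ifs with hk
    · exact hp.value_le_of_ne_purchased hInv hk hne
    · exact le_rfl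

end SearchProcess

/-! ### Incomplete observation -/

namespace Observation

variable {M : Type*} {P : SearchProblem M} {p : SearchProcess P} (O : Observation p) {z : M → ℝ}

theorem selected_of_lt {t : p.Step} (ht : t ∈ O.observed) (hlt : (t : ℕ) < p.inspected.length) :
    O.selected t = .identified (.inspect p.inspected[(t : ℕ)]) := by
  have hsel := p.selected_of_lt hlt
  rw [selected, hsel, record, if_pos]
  exact O.status_of_inspect t ht _ hsel

theorem selected_mem_choiceSet (t : p.Step) : O.selected t ∈ O.choiceSet t :=
  ⟨_, p.selected_mem_choices t, rfl⟩

/-- An unidentified action is a minimum, so it is below the true value whichever of the two actions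
is available. -/
theorem value_le_index (hInv : P.Invariance) {t : p.Step} {a : SearchAction M}
    (ha : a ∈ P.choices (p.history t)) :
    (O.record t a).value z p.value ≤ P.index z (p.history t) a.product := by
  rw [p.index_history hInv, record]
  by_cases hs : a.product ∈ O.status t
  · rw [if_pos hs]
    cases a with
    | inspect k => rw [if_neg (by exact (p.mem_inspectable_history hInv t k).1 ha)]; exact le_rfl
    | purchase k => rw [if_pos (by exact (p.mem_purchasable_history hInv t k).1 ha)]; exact le_rfl
  · rw [if_neg hs]
    split_ifs
    · exact min_le_right _ _
    · exact min_le_left _ _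

/-- The recorded selection of an inspection step is valued highest in the choice set. -/
theorem selected_value_le (hInv : P.Invariance) (hp : p.IsRanked z) {t : p.Step}
    (ht : t ∈ O.observed) (hlt : (t : ℕ) < p.inspected.length) {b : ObsAction M}
    (hb : b ∈ O.choiceSet t) : b.value z p.value ≤ (O.selected t).value z p.value := by
  obtain ⟨a, ha, rfl⟩ := hb
  rw [O.selected_of_lt ht hlt]
  exact (O.value_le_index hInv ha).trans (hp.index_le_getElem hInv hlt _)

/-- The earlier step is necessarily an identified inspection, which is never repeated and differs
from any record of a purchase. This makes the inequality strict when there are no ties. -/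
theorem selected_ne {j s : p.Step} (hj : j ∈ O.observed)
    (hs : s ∈ O.observed) (hjs : j < s) : O.selected s ≠ O.selected j := by
  have hjs' : (j : ℕ) < s := hjs
  have hjl : (j : ℕ) < p.inspected.length := by omega
  rw [O.selected_of_lt hj hjl]
  intro h
  rcases s.eq_castSucc_or_eq_last with ⟨i, rfl⟩ | rfl
  · rw [O.selected_of_lt hs i.isLt] at h
    simp only [ObsAction.identified.injEq, SearchAction.inspect.injEq] at h
    exact p.not_mem_take i.isLt (List.mem_take_iff_getElem.2 ⟨j, lt_min hjs' hjl, h.symm⟩)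
  · rw [selected, p.selected_last, record] at h
    split_ifs at h
    simp at h

open Classical in
-- Reduces unselected actions to remaining actions of unpurchased products: the purchased product
-- has both its inspection and its purchase selected.
theorem value_le_of_unselected (hInv : P.Invariance) {b : ObsAction M} (hb : b ∈ O.available)
    (hun : O.Unselected b) : ∃ k, k ≠ p.purchased ∧
      b.value z p.value ≤ if k ∈ p.inspected then p.value k else z k := by
  obtain ⟨t, a, ha, rfl⟩ := Set.mem_iUnion.1 hb
  refine ⟨a.product, ?_⟩
  rw [record] at hun ⊢
  by_cases hs : a.product ∈ O.status t
  · rw [if_pos hs] at hun ⊢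
    cases a with
    | inspect k =>
      have hk : k ∉ p.inspected := by
        intro hk
        obtain ⟨i, hi, rfl⟩ := List.mem_iff_getElem.1 hk
        exact hun ⟨i, by omega⟩ (p.selected_of_lt (t := ⟨i, by omega⟩) hi)
      refine ⟨?_, ?_⟩
      · rintro rfl
        exact hk p.purchased_mem
      · rw [if_neg (by exact hk)]; exact le_rfl
    | purchase k =>
      refine ⟨?_, ?_⟩
      · rintro rfl
        exact hun _ p.selected_last
      · rw [if_pos (by exact List.mem_of_mem_take ((p.mem_purchasable_history hInv t k).1 ha))]
        exact le_rfl
  · rw [if_neg hs] at hun ⊢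
    refine ⟨hun, ?_⟩
    split_ifs
    · exact min_le_right _ _
    · exact min_le_left _ _

open Classical in
-- If the purchase is recorded as unidentified, both entries of its minimum must be bounded: `z`
-- because the purchased product was inspected, the value by the ranking at the last step.
theorem le_selected_value (hInv : P.Invariance) (hp : p.IsRanked z) {t : p.Step}
    (ht : t ∈ O.observed) {k : M} (hne : k ≠ p.purchased) :
    (if k ∈ p.inspected then p.value k else z k) ≤ (O.selected t).value z p.value := by
  rcases t.eq_castSucc_or_eq_last with ⟨i, rfl⟩ | rfl
  · rw [O.selected_of_lt ht i.isLt]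
    exact hp.le_of_mem_inspected hInv hne (List.getElem_mem _)
  · have hu := hp.le_value_purchased hInv k
    rw [selected, p.selected_last, record]
    by_cases hs : (SearchAction.purchase p.purchased).product ∈ O.status (Fin.last _)
    · rw [if_pos hs]; exact hu
    · rw [if_neg hs]
      exact le_min (hp.le_of_mem_inspected hInv hne p.purchased_mem) hu

/-- The latest observed step has no later observed selection, hence is not forward-accessible;
finiteness then gives the minimum. -/
theorem exists_isCoreValue (hO : O.observed.Nonempty) (z : M → ℝ) : ∃ y, O.IsCoreValue z y := by
  have hfin : {v | ∃ t ∈ O.observed, ¬ O.ForwardAccessible t ∧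
      v = (O.selected t).value z p.value}.Finite :=
    (Set.finite_range fun t => (O.selected t).value z p.value).subset
      fun _ ⟨t, _, _, hv⟩ => ⟨t, hv.symm⟩
  obtain ⟨t, ht, hmax⟩ := O.observed.toFinite.exists_maximal hO
  have hna : ¬ O.ForwardAccessible t := fun ⟨_, _, _, s, hs, hts, _⟩ =>
    (hmax hs hts.le).not_gt hts
  obtain ⟨y, hy, hle⟩ := Set.exists_min_image _ id hfin ⟨_, t, ht, hna, rfl⟩
  exact ⟨y, hy, hle⟩

end Observation

/-- Necessary conditions for the optimality of a search process that is observed incompletely. -/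
theorem theorem2 {M : Type*} [Finite M] (P : SearchProblem M)
    (hInd : P.Independence) (hInv : P.Invariance)
    (z : M → ℝ)
    (hz : ∀ k, SearchProblem.IsReservationValue (P.belief [] k) (P.cost [] k) (z k))
    (p : SearchProcess P) (hopt : p.IsOptimal)
    (O : Observation p) (hO : O.observed.Nonempty) :
    (∀ j ∈ O.observed, ∀ s ∈ O.observed, j < s → O.selected s ∈ O.choiceSet j →
      (O.selected s).value z p.value ≤ (O.selected j).value z p.value ∧
      (Set.InjOn (fun b : ObsAction M => b.value z p.value) (O.choiceSet j) →
        (O.selected s).value z p.value < (O.selected j).value z p.value)) ∧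
    ∃ y : ℝ, O.IsCoreValue z y ∧
      ∀ b ∈ O.available, O.Unselected b → b.value z p.value ≤ y := by
  have hp := hopt.isRanked hInd hInv hz
  constructor
  · intro j hj s hs hjs hmem
    -- A step with a successor is an inspection, so its record is identified.
    have hlt : (j : ℕ) < p.inspected.length := by
      have : (j : ℕ) < s := hjs
      omega
    have hle := O.selected_value_le hInv hp hj hlt hmem
    refine ⟨hle, fun hinj => hle.lt_of_ne fun he => O.selected_ne hj hs hjs ?_⟩
    exact hinj hmem (O.selected_mem_choiceSet j) he
  · obtain ⟨y, hy⟩ := O.exists_isCoreValue hO z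
    refine ⟨y, hy, fun b hb hun => ?_⟩
    obtain ⟨t, ht, -, rfl⟩ := hy.1
    obtain ⟨k, hk, hle⟩ := O.value_le_of_unselected hInv hb hun
    exact hle.trans (O.le_selected_value hInv hp ht hk)
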